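/- Let $X$ be a real locally convex topological vector space with topological dual $X^*$. A convex polyhedron in $X$ is a set of the form $P=\{x\in X : \langle x_i^*,x\rangle\le\alpha_i,\ i=1,\dots,k\}$ with finitely many $x_i^*\in X^*$ and $\alpha_i\in\mathbb R$. For a convex set $\Omega\subset X$, its quasi-relative interior is $$\operatorname{qri}(\Omega)=\{x\in\Omega : \overline{\operatorname{cone}(\Omega-x)}\ \text{is a linear subspace of } X\},\qquad \operatorname{cone}(A)=\{ta : t\ge 0,\ a\in A\},$$ and its normal cone at $\bar x\in\Omega$ is $N(\bar x;\Omega)=\{x^*\in X^* : \langle x^*,x-\bar x\rangle\le 0\ \text{for all } x\in\Omega\}$, with $N(\bar x;\Omega)=\emptyset$ if $\bar x\notin\Omega$. Theorem 4.1. Let $P$ and $\Omega$ be nonempty convex subsets of $X$, where $P$ is a convex polyhedron, and assume that $P\cap\operatorname{qri}(\Omega)\neq\emptyset$. Then $$N(\bar x;P\cap\Omega)=N(\bar x;P)+N(\bar x;\Omega)\qquad\text{for all } \bar x\in P\cap\Omega .$$ -/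

import Mathlib

open scoped Pointwise

section

variable {X : Type*} [AddCommGroup X] [Module ℝ X]

/-- The conic hull `cone(A) = {t a | t ≥ 0, a ∈ A}`. -/
def conicHull (A : Set X) : Set X :=
  {y | ∃ t : ℝ, 0 ≤ t ∧ ∃ a ∈ A, y = t • a}

/-- The quasi-relative interior: the points `x ∈ Ω` such that the closure of `cone(Ω - x)` is a
linear subspace of `X`. -/
def qri [TopologicalSpace X] (Ω : Set X) : Set X :=
  {x | x ∈ Ω ∧ ∃ M : Submodule ℝ X,
    (M : Set X) = closure (conicHull {y | ∃ ω ∈ Ω, y = ω - x})}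

/-- A convex polyhedron: the solution set of finitely many inequalities `⟨f i, x⟩ ≤ α i` with
continuous linear functionals `f i`. -/
def IsConvexPolyhedron [TopologicalSpace X] (P : Set X) : Prop :=
  ∃ (k : ℕ) (f : Fin k → (X →L[ℝ] ℝ)) (α : Fin k → ℝ), P = {x | ∀ i, f i x ≤ α i}

/-- The normal cone to `Ω` at `xbar`; it is empty if `xbar ∉ Ω`. -/
def normalCone [TopologicalSpace X] (xbar : X) (Ω : Set X) : Set (X →L[ℝ] ℝ) :=
  {f | xbar ∈ Ω ∧ ∀ x ∈ Ω, f (x - xbar) ≤ 0}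

end

/-!
The inclusion `⊇` is immediate. For `⊆`, let `P = {x | ∀ i, f i x ≤ α i}` and let `h` be maximal
over `P ∩ Ω` at `x̄`. It suffices to find Lagrange multipliers `l i ≥ 0` with
`h x - h x̄ ≤ ∑ i, l i * (f i x - α i)` for every `x ∈ Ω`
(`exists_multipliers_of_le_on_polyhedron`): evaluating at `x̄` gives complementary slackness, so
`∑ i, l i • f i` is normal to `P` and `h - ∑ i, l i • f i` is normal to `Ω`.

Only one property of a point `x₀ ∈ qri Ω` is needed (`IsNonsupport`): a continuous linear functional
whose maximum over `Ω` is attained at `x₀` is constant on `Ω`. The multipliers are found by induction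
on the number of constraints. The theorem of the alternative
(`exists_nonneg_combination_nonneg`) gives nonnegative `m` and `l`, not all zero, with
`m * (h x - h x̄) ≤ ∑ i, l i * (f i x - α i)` on `Ω`. If `m > 0`, divide by `m`. If `m = 0`, the
right-hand side is minimal at `x₀`, hence vanishes on `Ω`. Choose `j` with `l j > 0`. Then
`f j x₀ = α j`, and `x₀` keeps its property on the slice `Ω ∩ {f j = α j}`
(`IsNonsupport.inter_eq`), to which the induction hypothesis applies with the constraint `j` removed.
A multiplier of unknown sign for the equation `f j = α j` (`IsNonsupport.exists_multiplier_eq`)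
extends the estimate from the slice to `Ω`; adding a large multiple of the vanishing combination
`∑ i, l i * (f i x - α i)` makes that multiplier nonnegative.
-/

/-! ### A theorem of the alternative -/

/-- The theorem of the alternative of Fan, Glicksberg and Hoffman: if finitely many convex functions
are nowhere simultaneously negative on `Ω`, then some nontrivial nonnegative combination of them is
nonnegative on `Ω`. -/
lemma exists_nonneg_combination_nonneg {E ι : Type*} [AddCommGroup E] [Module ℝ E] [Fintype ι]
    [Nonempty ι] {Ω : Set E} {u : ι → E → ℝ} (hu : ∀ i, ConvexOn ℝ Ω (u i))
    (h : ∀ x ∈ Ω, ∃ i, 0 ≤ u i x) :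
    ∃ l : ι → ℝ, (∀ i, 0 ≤ l i) ∧ (∃ i, 0 < l i) ∧ ∀ x ∈ Ω, 0 ≤ ∑ i, l i * u i x := by
  classical
  rcases Ω.eq_empty_or_nonempty with rfl | ⟨x₁, hx₁⟩
  · exact ⟨fun _ => 1, fun _ => zero_le_one, ⟨Classical.arbitrary ι, zero_lt_one⟩, by simp⟩
  -- Separate the open negative orthant from the upward closure of the image of `Ω`.
  let A : Set (ι → ℝ) := {y | ∃ x ∈ Ω, ∀ i, u i x ≤ y i}
  let B : Set (ι → ℝ) := Set.univ.pi fun _ => Set.Iio 0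
  have hA : Convex ℝ A := by
    rintro y ⟨x, hx, hxy⟩ z ⟨w, hw, hwz⟩ a b ha hb hab
    refine ⟨a • x + b • w, (hu (Classical.arbitrary ι)).1 hx hw ha hb hab, fun i => ?_⟩
    refine ((hu i).2 hx hw ha hb hab).trans ?_
    have h1 := mul_le_mul_of_nonneg_left (hxy i) ha
    have h2 := mul_le_mul_of_nonneg_left (hwz i) hb
    simpa using add_le_add h1 h2
  have hB : Convex ℝ B := convex_pi fun _ _ => convex_Iio 0
  have hBo : IsOpen B := isOpen_set_pi Set.finite_univ fun _ _ => isOpen_Iio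
  have hdisj : Disjoint B A := by
    rw [Set.disjoint_left]
    rintro y hy ⟨x, hx, hxy⟩
    obtain ⟨i, hi⟩ := h x hx
    exact absurd (hi.trans (hxy i)) (not_le.2 (hy i trivial))
  obtain ⟨g, r, hgB, hgA⟩ := geometric_hahn_banach_open hB hBo hA hdisj
  have hg (y : ι → ℝ) : g y = ∑ i, g (Pi.single i 1) * y i := by
    conv_lhs => rw [pi_eq_sum_univ' y]
    simp [mul_comm]
  have hr : 0 ≤ r := by
    by_contra! hr
    have ht : Filter.Tendsto (fun t : ℝ => g (t • fun _ => -1)) (nhdsWithin 0 (Set.Ioi 0))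
        (nhds 0) := by
      have : Continuous fun t : ℝ => g (t • fun _ => -1) := by fun_prop
      simpa using (this.tendsto 0).mono_left nhdsWithin_le_nhds
    refine absurd (le_of_tendsto ht ?_) (not_le.2 hr)
    filter_upwards [self_mem_nhdsWithin] with t ht
    exact (hgB _ fun i _ => by simpa using ht).le
  refine ⟨fun i => g (Pi.single i 1), fun i => ?_, ?_, fun x hx => ?_⟩
  · by_contra! hi
    -- A negative coefficient would make `g` unbounded below on the upward closed set `A`.
    obtain ⟨n, hn⟩ := exists_nat_gt ((g (fun j => u j x₁) - r) / -g (Pi.single i 1))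
    rw [div_lt_iff₀ (by linarith)] at hn
    have := hgA ((fun j => u j x₁) + (n : ℝ) • Pi.single i (1 : ℝ)) ⟨x₁, hx₁, fun j => by
      have : (0 : ℝ) ≤ (Pi.single i 1 : ι → ℝ) j := by
        rw [Pi.single_apply]; split_ifs <;> norm_num
      simpa using mul_nonneg n.cast_nonneg this⟩
    rw [map_add, map_smul, smul_eq_mul] at this
    linarith
  · by_contra! hl
    have h1 : 0 ≤ g fun _ => -1 := by
      rw [hg]
      exact Finset.sum_nonneg fun i _ => mul_nonneg_of_nonpos_of_nonpos (hl i) (by norm_num)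
    have h2 := hgB (fun _ => -1) fun i _ => by simp
    have h3 := hgA (fun _ => max 0 (Finset.univ.sup' Finset.univ_nonempty fun i => u i x₁))
      ⟨x₁, hx₁, fun i => le_max_of_le_right (Finset.le_sup' (fun i => u i x₁) (Finset.mem_univ i))⟩
    have h4 : g (fun _ => max 0 (Finset.univ.sup' Finset.univ_nonempty fun i => u i x₁)) ≤ 0 := by
      rw [hg]
      exact Finset.sum_nonpos fun i _ => mul_nonpos_of_nonpos_of_nonneg (hl i) (le_max_left _ _)
    linarith
  · rw [← hg fun i => u i x]
    exact hr.trans (hgA _ ⟨x, hx, fun i => le_rfl⟩)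

/-! ### Nonsupport points -/

section

variable {X : Type*} [AddCommGroup X] [Module ℝ X] [TopologicalSpace X]

/-- `x₀` is a nonsupport point of `Ω`: a continuous linear functional attaining its maximum over `Ω`
at `x₀` is constant on `Ω`. Membership of `x₀` in `Ω` is not part of the definition. -/
def IsNonsupport (x₀ : X) (Ω : Set X) : Prop :=
  ∀ g : X →L[ℝ] ℝ, (∀ x ∈ Ω, g x ≤ g x₀) → ∀ x ∈ Ω, g x = g x₀

lemma isNonsupport_of_mem_qri {x₀ : X} {Ω : Set X} (h : x₀ ∈ qri Ω) : IsNonsupport x₀ Ω := by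
  obtain ⟨-, M, hM⟩ := h
  intro g hg x hx
  have hle : ∀ y ∈ M, g y ≤ 0 := by
    intro y hy
    rw [← SetLike.mem_coe, hM] at hy
    refine closure_minimal ?_ (isClosed_Iic.preimage g.continuous) hy
    rintro _ ⟨t, ht, _, ⟨ω, hω, rfl⟩, rfl⟩
    simpa using mul_nonpos_of_nonneg_of_nonpos ht (sub_nonpos.2 (hg ω hω))
  have hxM : x - x₀ ∈ M := by
    rw [← SetLike.mem_coe, hM]
    exact subset_closure ⟨1, zero_le_one, _, ⟨x, hx, rfl⟩, (one_smul _ _).symm⟩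
  have h1 := hle _ hxM
  have h2 := hle _ (M.neg_mem hxM)
  simp only [map_neg, map_sub] at h1 h2
  linarith

/-- Existence of a multiplier for one linear equation satisfied at a nonsupport point. If `g - a`
changes sign on `Ω`, the multiplier is a slope separating the two sides of the hyperplane. -/
lemma IsNonsupport.exists_multiplier_eq {x₀ : X} {Ω : Set X} (hx₀ : IsNonsupport x₀ Ω)
    (hΩ : Convex ℝ Ω) (g φ : X →L[ℝ] ℝ) {a c : ℝ} (ha : g x₀ = a)
    (hφ : ∀ x ∈ Ω, g x = a → φ x ≤ c) :
    ∃ m : ℝ, ∀ x ∈ Ω, φ x - c ≤ m * (g x - a) := by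
  by_cases hpos : ∀ x ∈ Ω, g x ≤ a
  · have := hx₀ g (by simpa [ha] using hpos)
    exact ⟨0, fun x hx => by linarith [hφ x hx ((this x hx).trans ha)]⟩
  by_cases hneg : ∀ x ∈ Ω, a ≤ g x
  · have := hx₀ (-g) (by simpa [ha] using hneg)
    exact ⟨0, fun x hx => by linarith [hφ x hx ((neg_injective (this x hx)).trans ha)]⟩
  push Not at hpos hneg
  obtain ⟨p, hp, hpa⟩ := hpos
  obtain ⟨q, hq, hqa⟩ := hneg
  let S : Set ℝ := {r | ∃ x ∈ Ω, a < g x ∧ r = (φ x - c) / (g x - a)}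
  let T : Set ℝ := {r | ∃ y ∈ Ω, g y < a ∧ r = (c - φ y) / (a - g y)}
  obtain ⟨m, hmS, hmT⟩ : (upperBounds S ∩ lowerBounds T).Nonempty := by
    refine exists_between_of_forall_le ⟨_, p, hp, hpa, rfl⟩ ⟨_, q, hq, hqa, rfl⟩ ?_
    rintro _ ⟨x, hx, hxa, rfl⟩ _ ⟨y, hy, hya, rfl⟩
    have hx' : 0 < g x - a := sub_pos.2 hxa
    have hy' : 0 < a - g y := sub_pos.2 hya
    have hd : 0 < g x - g y := by linarith
    -- The segment from `x` to `y` meets the hyperplane `g = a`, where `φ ≤ c`.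
    have hmem := hΩ hx hy (div_nonneg hy'.le hd.le) (div_nonneg hx'.le hd.le)
      (by field_simp; ring)
    have key := hφ _ hmem (by simp; field_simp; ring)
    simp only [map_add, map_smul, smul_eq_mul] at key
    rw [div_mul_eq_mul_div, div_mul_eq_mul_div, ← add_div, div_le_iff₀ hd] at key
    rw [div_le_div_iff₀ hx' hy']
    linarith
  refine ⟨m, fun x hx => ?_⟩
  rcases lt_trichotomy (g x) a with hxa | hxa | hxa
  · have := hmT ⟨x, hx, hxa, rfl⟩
    rw [le_div_iff₀ (sub_pos.2 hxa)] at this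
    linarith
  · simpa [hxa] using hφ x hx hxa
  · have := hmS ⟨x, hx, hxa, rfl⟩
    rwa [div_le_iff₀ (sub_pos.2 hxa)] at this

lemma IsNonsupport.inter_eq [IsTopologicalAddGroup X] {x₀ : X} {Ω : Set X}
    (hx₀ : IsNonsupport x₀ Ω) (hΩ : Convex ℝ Ω) (g : X →L[ℝ] ℝ) {a : ℝ} (ha : g x₀ = a) :
    IsNonsupport x₀ (Ω ∩ {x | g x = a}) := by
  rintro φ hφ x ⟨hx, hxa⟩
  obtain ⟨m, hm⟩ := hx₀.exists_multiplier_eq hΩ g φ ha fun y hy hya => hφ y ⟨hy, hya⟩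
  have := hx₀ (φ - m • g) (fun y hy => by
    have := hm y hy
    simp only [sub_apply, smul_apply, smul_eq_mul, ha]
    linarith) x hx
  simp only [sub_apply, smul_apply, smul_eq_mul, ha, hxa.out] at this
  linarith

/-! ### Lagrange multipliers for polyhedral constraints -/

/-- Strong Lagrange duality for finitely many linear inequalities over a convex set `Ω`: no strict
feasibility is required, only a feasible nonsupport point of `Ω`. -/
lemma exists_multipliers_of_le_on_polyhedron [IsTopologicalAddGroup X] [ContinuousSMul ℝ X]
    {x₀ : X} {n : ℕ} {Ω : Set X} (hΩ : Convex ℝ Ω) (hmem : x₀ ∈ Ω) (hx₀ : IsNonsupport x₀ Ω)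
    (f : Fin n → X →L[ℝ] ℝ) (α : Fin n → ℝ) (hf : ∀ i, f i x₀ ≤ α i) (h : X →L[ℝ] ℝ) {c : ℝ}
    (hc : ∀ x ∈ Ω, (∀ i, f i x ≤ α i) → h x ≤ c) :
    ∃ l : Fin n → ℝ, (∀ i, 0 ≤ l i) ∧ ∀ x ∈ Ω, h x - c ≤ ∑ i, l i * (f i x - α i) := by
  induction n generalizing Ω h with
  | zero => exact ⟨fun _ => 0, fun _ => le_rfl, fun x hx => by simpa using hc x hx (by simp)⟩
  | succ n ih =>
    have haff (g : X →L[ℝ] ℝ) (b : ℝ) : ConvexOn ℝ Ω fun x => g x - b :=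
      (g.toLinearMap.convexOn hΩ).add_const (-b)
    obtain ⟨l, hl, hpos, hcomb⟩ := exists_nonneg_combination_nonneg
      (ι := Option (Fin (n + 1))) (Ω := Ω)
      (u := fun o x => o.elim ((-h) x - -c) fun i => f i x - α i)
      (by
        rintro (_ | i)
        · exact haff (-h) (-c)
        · exact haff (f i) (α i))
      (by
        intro x hx
        by_contra! hneg
        have h1 : (-h) x - -c < 0 := hneg none
        have h2 := hc x hx fun i => (sub_neg.1 (hneg (some i))).le
        simp only [neg_apply] at h1
        linarith)
    simp only [Fintype.sum_option, Option.elim, neg_apply] at hcomb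
    rcases (hl none).lt_or_eq with hm | hm
    · refine ⟨fun i => l (some i) / l none, fun i => div_nonneg (hl _) hm.le, fun x hx => ?_⟩
      have := hcomb x hx
      simp only [div_mul_eq_mul_div, ← Finset.sum_div]
      rw [le_div_iff₀ hm]
      linarith
    simp only [← hm, zero_mul, zero_add] at hcomb
    obtain ⟨j, hj⟩ : ∃ j, 0 < l (some j) := by
      obtain ⟨_ | j, hj⟩ := hpos
      · exact absurd hm hj.ne
      · exact ⟨j, hj⟩
    have hterm (i) : l (some i) * (f i x₀ - α i) ≤ 0 :=
      mul_nonpos_of_nonneg_of_nonpos (hl _) (sub_nonpos.2 (hf i))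
    have hsum₀ : ∑ i, l (some i) * (f i x₀ - α i) = 0 :=
      le_antisymm (Finset.sum_nonpos fun i _ => hterm i) (hcomb x₀ hmem)
    have hj₀ : f j x₀ = α j := by
      have := (Finset.sum_eq_zero_iff_of_nonpos fun i _ => hterm i).1 hsum₀ j (Finset.mem_univ j)
      exact sub_eq_zero.1 ((mul_eq_zero.1 this).resolve_left hj.ne')
    have hsum : ∀ x ∈ Ω, ∑ i, l (some i) * (f i x - α i) = 0 := by
      have hval (x : X) : (-∑ i, l (some i) • f i) x =
          -(∑ i, l (some i) * (f i x - α i)) - ∑ i, l (some i) * α i := by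
        simp [mul_sub, Finset.sum_sub_distrib]
      intro x hx
      have := hx₀ (-∑ i, l (some i) • f i) (fun y hy => by
        rw [hval, hval, hsum₀]
        linarith [hcomb y hy]) x hx
      rw [hval, hval, hsum₀] at this
      linarith
    obtain ⟨k, hk, hkΩ⟩ := ih (Ω := Ω ∩ {x | f j x = α j})
      (hΩ.inter (convex_hyperplane (f j).toLinearMap.isLinear _)) ⟨hmem, hj₀⟩
      (hx₀.inter_eq hΩ (f j) hj₀) (fun i => f (j.succAbove i)) (fun i => α (j.succAbove i))
      (fun i => hf _) h fun x hx hxf => hc x hx.1 <|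
        (Fin.forall_iff_succAbove j).2 ⟨hx.2.le, hxf⟩
    have hkval (x : X) : (h - ∑ i, k i • f (j.succAbove i)) x =
        h x - ∑ i, k i * (f (j.succAbove i) x - α (j.succAbove i)) -
          ∑ i, k i * α (j.succAbove i) := by
      simp [mul_sub, Finset.sum_sub_distrib, sub_sub]
    obtain ⟨m, hmΩ⟩ := hx₀.exists_multiplier_eq hΩ (f j) (h - ∑ i, k i • f (j.succAbove i))
      (c := c - ∑ i, k i * α (j.succAbove i)) hj₀ fun x hx hxj => by
        rw [hkval]
        linarith [hkΩ x ⟨hx, hxj⟩]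
    -- `|m| / l j` copies of the vanishing combination compensate a negative `m`.
    refine ⟨fun i => j.insertNth (α := fun _ => ℝ) m k i + |m| / l (some j) * l (some i),
      (Fin.forall_iff_succAbove j).2 ⟨?_, fun i => ?_⟩, fun x hx => ?_⟩
    · beta_reduce
      rw [Fin.insertNth_apply_same, div_mul_cancel₀ _ hj.ne']
      linarith [neg_abs_le m]
    · beta_reduce
      rw [Fin.insertNth_apply_succAbove]
      exact add_nonneg (hk i) (mul_nonneg (div_nonneg (abs_nonneg m) hj.le) (hl _))
    · have h1 := hmΩ x hx
      rw [hkval] at h1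
      simp only [add_mul, Finset.sum_add_distrib, mul_assoc, ← Finset.mul_sum, hsum x hx, mul_zero,
        add_zero]
      rw [Fin.sum_univ_succAbove _ j]
      simp only [Fin.insertNth_apply_same, Fin.insertNth_apply_succAbove]
      linarith

end

/-! ### The intersection rule for normal cones -/

theorem theorem4p1 {X : Type*} [AddCommGroup X] [Module ℝ X] [TopologicalSpace X]
    [IsTopologicalAddGroup X] [ContinuousSMul ℝ X] [LocallyConvexSpace ℝ X]
    (P Ω : Set X) (hP : IsConvexPolyhedron P) (hΩ : Convex ℝ Ω)
    (hqri : (P ∩ qri Ω).Nonempty) :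
    ∀ xbar ∈ P ∩ Ω,
      normalCone xbar (P ∩ Ω) = normalCone xbar P + normalCone xbar Ω := by
  obtain ⟨n, f, α, rfl⟩ := hP
  obtain ⟨x₀, hx₀P, hx₀⟩ := hqri
  rintro xbar ⟨hxP, hxΩ⟩
  ext h
  constructor
  · rintro ⟨-, hh⟩
    obtain ⟨l, hl, hlΩ⟩ := exists_multipliers_of_le_on_polyhedron hΩ hx₀.1
      (isNonsupport_of_mem_qri hx₀) f α hx₀P h (c := h xbar) fun x hx hxf => by
        simpa using hh x ⟨hxf, hx⟩
    have hterm {x : X} (hx : ∀ i, f i x ≤ α i) : ∑ i, l i * (f i x - α i) ≤ 0 :=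
      Finset.sum_nonpos fun i _ => mul_nonpos_of_nonneg_of_nonpos (hl i) (sub_nonpos.2 (hx i))
    -- Complementary slackness.
    have hslack : ∑ i, l i * (f i xbar - α i) = 0 :=
      le_antisymm (hterm hxP) (by simpa using hlΩ xbar hxΩ)
    have hval (x : X) : (∑ i, l i • f i) (x - xbar) = ∑ i, l i * (f i x - α i) := by
      rw [← sub_zero (∑ i, l i * (f i x - α i)), ← hslack, ← Finset.sum_sub_distrib]
      simp [← mul_sub]
    refine Set.mem_add.2 ⟨∑ i, l i • f i, ⟨hxP, fun x hx => ?_⟩, h - ∑ i, l i • f i,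
      ⟨hxΩ, fun x hx => ?_⟩, add_sub_cancel _ _⟩
    · rw [hval]
      exact hterm hx
    · rw [sub_apply, hval, map_sub]
      linarith [hlΩ x hx]
  · rintro ⟨p, ⟨-, hp⟩, q, ⟨-, hq⟩, rfl⟩
    exact ⟨⟨hxP, hxΩ⟩, fun x hx => add_nonpos (hp x hx.1) (hq x hx.2)⟩
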